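/- For a square-free integer $d\neq 1$ let $K_d=\mathbb{Q}(\sqrt d)$, let $h_d$ be the class number of $K_d$, and let $a_n$ ($n\ge 1$) be the Dirichlet coefficients of its Dedekind zeta function $\zeta_{K_d}(s)=\sum_{n\ge1}a_nn^{-s}$, so that $a_n$ is the number of ideals of norm $n$ in the ring of integers of $K_d$. Let $p\equiv 1\pmod 4$ be a prime. Then $a_p=1$ if and only if $p$ ramifies in $K_d$; and if $h_d=1$ and $a_p=1$, then $d=p$. -/

import Mathlib

namespace Quad

noncomputable section

/-- The field `K_d = ℚ(√d)`, as a subfield of `ℂ`. -/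
def K (d : ℤ) : IntermediateField ℚ ℂ :=
  IntermediateField.adjoin ℚ {Complex.sqrt (d : ℂ)}

theorem sqrt_pow_two (d : ℤ) : Complex.sqrt (d : ℂ) ^ 2 = (d : ℂ) :=
  Complex.cpow_ofNat_inv_pow (d : ℂ) 2

theorem isIntegral_sqrt (d : ℤ) : IsIntegral ℚ (Complex.sqrt (d : ℂ)) := by
  refine IsIntegral.of_pow (n := 2) (by norm_num) ?_
  rw [sqrt_pow_two]
  exact_mod_cast isIntegral_algebraMap (R := ℚ) (A := ℂ) (x := (d : ℚ))

instance (d : ℤ) : NumberField (K d) where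
  to_charZero := inferInstance
  to_finiteDimensional := IntermediateField.adjoin.finiteDimensional (isIntegral_sqrt d)

/-- The class number `h_d` of `K_d`. -/
def h (d : ℤ) : ℕ := NumberField.classNumber (K d)

/-- The `n`-th Dirichlet coefficient `a_n` (for `n ≥ 1`) of the Dedekind zeta function of `K_d`:
since `ζ_{K_d}(s) = ∑_I N(I)^{-s}`, it is the number of ideals `I` of norm `n`. -/
def a (d : ℤ) (n : ℕ) : ℕ :=
  Nat.card {I : Ideal (NumberField.RingOfIntegers (K d)) // Ideal.absNorm I = n}

/-- The numbers `a d n` are the coefficients of Mathlib's Dedekind zeta function. -/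
theorem dedekindZeta_eq (d : ℤ) (s : ℂ) :
    NumberField.dedekindZeta (K d) s = LSeries (fun n => (a d n : ℂ)) s :=
  rfl

/-- The rational prime `p` ramifies in `K_d`: some prime of `K_d` above `p` has ramification
index greater than `1`. -/
def Ramifies (d : ℤ) (p : ℕ) : Prop :=
  ∃ P ∈ (Ideal.span {(p : ℤ)}).primesOver (NumberField.RingOfIntegers (K d)),
    1 < P.ramificationIdx ℤ

end

end Quad

/-! The first claim is `∑ e f = 2` over the primes above `p`: an ideal of norm `p` is a prime with
`f = 1`, and it is alone exactly when `e = 2` (`card_absNorm_eq_one_iff`). For the second, a unique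
ideal of norm `p` is stable under conjugation, which forces `p ∣ d` (`dvd_of_card_absNorm_eq_one`).
Write `d = p * m` and suppose `m ≠ 1`. Dirichlet's theorem and reciprocity give a prime `q` that is
a non-residue mod `p`, with `p` and `m` both non-residues mod `q`
(`exists_prime_jacobiSym_eq_neg_one`). Then `d` is a square mod `q`, so class number one makes `q`
or `-q` a norm (`exists_mul_conj_eq_prime`). Norms are squares mod `p` up to the factor 4, and `-1`
is a square mod `p`, so `q` would be a residue: a contradiction. -/

namespace Quad

/-! ### Ideals of prime norm -/

section NumberField

open NumberField Ideal

variable {F : Type*} [Field F] [NumberField F]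

theorem mem_primesOver_of_absNorm_eq {p : ℕ} (hp : p.Prime) {I : Ideal (𝓞 F)}
    (hI : absNorm I = p) : I ∈ (span {(p : ℤ)}).primesOver (𝓞 F) := by
  have hprime : I.IsPrime := isPrime_of_irreducible_absNorm (by rw [hI]; exact hp)
  refine ⟨hprime, ?_⟩
  have h1 : absNorm (under ℤ I) = p := by
    refine ((Nat.dvd_prime hp).mp (hI ▸ Int.absNorm_under_dvd_absNorm I)).resolve_left fun h ↦ ?_
    rw [absNorm_eq_one_iff] at h
    exact (hprime.under ℤ).ne_top h
  rw [← h1]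
  exact Int.liesOver_span_absNorm I

/-- In a quadratic field there is exactly one ideal of norm `p` if and only if some prime above `p`
has ramification index greater than one. -/
theorem card_absNorm_eq_one_iff (h2 : Module.finrank ℚ F = 2) {p : ℕ} (hp : p.Prime) :
    Nat.card {I : Ideal (𝓞 F) // absNorm I = p} = 1 ↔
      ∃ P ∈ (span {(p : ℤ)}).primesOver (𝓞 F), 1 < P.ramificationIdx ℤ := by
  classical
  have hpZ : Prime (p : ℤ) := Nat.prime_iff_prime_int.mp hp
  have : (span {(p : ℤ)}).IsPrime := (span_singleton_prime hpZ.ne_zero).mpr hpZ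
  have : Fintype ((span {(p : ℤ)}).primesOver (𝓞 F)) :=
    (Algebra.QuasiFinite.finite_primesOver _).fintype
  have hsum := sum_ramification_inertia_eq_finrank (span {(p : ℤ)}) (𝓞 F)
  rw [RingOfIntegers.rank, h2] at hsum
  have hpos (Q : (span {(p : ℤ)}).primesOver (𝓞 F)) :
      0 < Q.1.ramificationIdx ℤ ∧ 0 < Q.1.inertiaDeg ℤ :=
    ⟨ramificationIdx_pos Q.1 ℤ, inertiaDeg_pos Q.1 ℤ⟩
  have hnorm (Q : (span {(p : ℤ)}).primesOver (𝓞 F)) : absNorm Q.1 = p ^ Q.1.inertiaDeg ℤ :=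
    (pow_inertiaDeg p Q.1).symm
  constructor
  · intro h
    obtain ⟨hsub, ⟨P, hP⟩⟩ := Nat.card_eq_one_iff_unique.mp h
    have hPo := mem_primesOver_of_absNorm_eq hp hP
    refine ⟨P, hPo, ?_⟩
    by_contra! he
    have hf : P.inertiaDeg ℤ = 1 := by
      have := hnorm ⟨P, hPo⟩
      rw [hP] at this
      exact (Nat.pow_right_injective hp.two_le (by simpa using this)).symm
    have he : P.ramificationIdx ℤ = 1 := le_antisymm he (hpos ⟨P, hPo⟩).1
    -- `P` contributes only 1 to the sum 2, so another prime has `e = f = 1` and is a second ideal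
    -- of norm `p`.
    rw [← Finset.add_sum_erase _ _ (Finset.mem_univ ⟨P, hPo⟩)] at hsum
    have hsum' : ∑ Q ∈ Finset.univ.erase (⟨P, hPo⟩ : (span {(p : ℤ)}).primesOver (𝓞 F)),
        Q.1.ramificationIdx ℤ * Q.1.inertiaDeg ℤ = 1 := by
      rw [he, hf] at hsum
      exact Nat.add_left_cancel (n := 1) hsum
    obtain ⟨Q, hQ, -⟩ := Finset.exists_ne_zero_of_sum_ne_zero (hsum'.trans_ne one_ne_zero)
    have hle := Finset.single_le_sum (f := fun Q : (span {(p : ℤ)}).primesOver (𝓞 F) ↦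
      Q.1.ramificationIdx ℤ * Q.1.inertiaDeg ℤ) (fun _ _ ↦ Nat.zero_le _) hQ
    rw [hsum'] at hle
    have hfQ : Q.1.inertiaDeg ℤ = 1 := by
      have := hpos Q
      nlinarith
    have hQn : absNorm Q.1 = p := by rw [hnorm, hfQ, pow_one]
    have := hsub.elim ⟨Q.1, hQn⟩ ⟨P, hP⟩
    exact (Finset.mem_erase.mp hQ).1 (Subtype.ext (Subtype.mk.inj this))
  · rintro ⟨P, hPo, he⟩
    rw [← Finset.add_sum_erase _ _ (Finset.mem_univ ⟨P, hPo⟩)] at hsum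
    have hfpos := (hpos ⟨P, hPo⟩).2
    simp only at hsum hfpos
    have hf : P.inertiaDeg ℤ = 1 := by
      by_contra hf
      have := Nat.mul_le_mul he (show 2 ≤ P.inertiaDeg ℤ by omega)
      omega
    rw [hf] at hsum
    have hPn : absNorm P = p := by rw [hnorm ⟨P, hPo⟩, hf, pow_one]
    rw [Nat.card_eq_one_iff_unique]
    refine ⟨⟨fun I J ↦ ?_⟩, ⟨P, hPn⟩⟩
    have key (I : {I : Ideal (𝓞 F) // absNorm I = p}) : I.1 = P := by
      by_contra hne
      have hIo := mem_primesOver_of_absNorm_eq hp I.2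
      have hmem : (⟨I.1, hIo⟩ : (span {(p : ℤ)}).primesOver (𝓞 F)) ∈
          Finset.univ.erase ⟨P, hPo⟩ :=
        Finset.mem_erase.mpr ⟨fun h ↦ hne (Subtype.mk.inj h), Finset.mem_univ _⟩
      have hle := Finset.single_le_sum (f := fun Q : (span {(p : ℤ)}).primesOver (𝓞 F) ↦
        Q.1.ramificationIdx ℤ * Q.1.inertiaDeg ℤ) (fun _ _ ↦ Nat.zero_le _) hmem
      have hzero (s : ℕ) (hs : P.ramificationIdx ℤ * 1 + s = 2) : s = 0 := by omega
      rw [hzero _ hsum] at hle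
      exact (Nat.mul_pos (hpos ⟨I.1, hIo⟩).1 (hpos ⟨I.1, hIo⟩).2).not_ge hle
    exact Subtype.ext ((key I).trans (key J).symm)

/-- Modulo an ideal of prime norm, every element is congruent to an integer. -/
theorem exists_sub_intCast_mem {p : ℕ} (hp : p.Prime) {P : Ideal (𝓞 F)} (hP : absNorm P = p)
    (x : 𝓞 F) : ∃ t : ℤ, x - t ∈ P := by
  have := Fact.mk hp
  have hcard : Nat.card (𝓞 F ⧸ P) = p := by
    rw [← hP, absNorm_apply, Submodule.cardQuot_apply]
  have hP1 : P ≠ ⊤ := (mem_primesOver_of_absNorm_eq hp hP).1.ne_top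
  have : Nontrivial (𝓞 F ⧸ P) := Quotient.nontrivial_iff.mpr hP1
  obtain ⟨t, ht⟩ := mem_zmultiples_of_prime_card (G := 𝓞 F ⧸ P) (g' := Ideal.Quotient.mk P x)
    hcard (one_ne_zero)
  refine ⟨t, ?_⟩
  rw [← Ideal.Quotient.eq, map_intCast, ← ht]
  simp

theorem intCast_mem_iff_of_absNorm_eq {p : ℕ} (hp : p.Prime) {P : Ideal (𝓞 F)}
    (hP : absNorm P = p) (n : ℤ) : (n : 𝓞 F) ∈ P ↔ (p : ℤ) ∣ n := by
  have := (mem_primesOver_of_absNorm_eq hp hP).2.over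
  rw [← mem_span_singleton, this, mem_comap, eq_intCast]

theorem absNorm_comap_ringEquiv (e : 𝓞 F ≃+* 𝓞 F) (P : Ideal (𝓞 F)) :
    absNorm (P.comap e) = absNorm P := by
  simp only [absNorm_apply, Submodule.cardQuot_apply]
  refine Nat.card_congr (Ideal.quotientEquiv (P.comap e) P e ?_).toEquiv
  exact (map_comap_of_surjective _ e.surjective P).symm

end NumberField

/-! ### Quadratic residues and an auxiliary prime -/

section Arithmetic

theorem exists_jacobiSym_eq_neg_one {l : ℕ} (hl : l.Prime) (hl2 : Odd l) :
    ∃ c : ℕ, jacobiSym c l = -1 := by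
  have := Fact.mk hl
  obtain ⟨a, ha⟩ := FiniteField.exists_nonsquare (F := ZMod l) (by
    rw [ZMod.ringChar_zmod_n]; rintro rfl; exact absurd hl2 (by decide))
  refine ⟨a.val, ?_⟩
  rw [ZMod.nonsquare_iff_jacobiSym_eq_neg_one]
  simpa using ha

theorem coprime_of_jacobiSym_eq_neg_one {c l : ℕ} (h : jacobiSym c l = -1) : c.Coprime l := by
  by_contra hc
  have hl : l ≠ 0 := by rintro rfl; simp at h
  rw [jacobiSym.eq_zero_iff.mpr ⟨hl, by simpa using hc⟩] at h
  simp at h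

theorem jacobiSym_congr {a b n : ℕ} (h : a ≡ b [MOD n]) : jacobiSym a n = jacobiSym b n :=
  jacobiSym.mod_left' (by exact_mod_cast h)

/-- A square-free integer other than `1` is a non-residue modulo every prime in some residue class. -/
theorem exists_modulus_jacobiSym_eq_neg_one {m : ℤ} (hm : Squarefree m) (hm1 : m ≠ 1) {p : ℕ}
    (hp : p.Prime) (hp2 : Odd p) (hpm : ¬ (p : ℤ) ∣ m) :
    ∃ M r : ℕ, M ≠ 0 ∧ r.Coprime M ∧ p.Coprime M ∧
      ∀ q : ℕ, q ≡ r [MOD M] → Odd q ∧ jacobiSym m q = -1 := by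
  have hp4 : p.Coprime 4 := by
    simpa using Nat.Coprime.pow_right 2 (Nat.coprime_two_right.mpr hp2)
  rcases Nat.eq_two_pow_or_exists_odd_prime_and_dvd m.natAbs with ⟨k, hk⟩ | ⟨l, hl, hlm, hl2⟩
  · have hk1 : k ≤ 1 := by
      have hs : Squarefree (2 ^ k : ℕ) := hk ▸ Int.squarefree_natAbs.mpr hm
      by_contra! hk2
      exact absurd (hs 2 (pow_dvd_pow 2 hk2)) (by decide)
    have hp8 : p.Coprime 8 := by
      simpa using Nat.Coprime.pow_right 3 (Nat.coprime_two_right.mpr hp2)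
    have hcases : m = -1 ∨ m = 2 ∨ m = -2 := by
      interval_cases k <;> omega
    rcases hcases with rfl | rfl | rfl
    · refine ⟨8, 3, by norm_num, by decide, hp8, fun q hq ↦ ?_⟩
      have hq : q % 8 = 3 := hq
      have hodd : Odd q := Nat.odd_iff.mpr (by omega)
      refine ⟨hodd, ?_⟩
      rw [jacobiSym.at_neg_one hodd, ZMod.χ₄_nat_three_mod_four (by omega)]
    · refine ⟨8, 5, by norm_num, by decide, hp8, fun q hq ↦ ?_⟩
      have hq : q % 8 = 5 := hq
      have hodd : Odd q := Nat.odd_iff.mpr (by omega)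
      refine ⟨hodd, ?_⟩
      rw [jacobiSym.at_two hodd, ZMod.χ₈_nat_eq_if_mod_eight, if_neg (by omega), if_neg (by omega)]
    · refine ⟨8, 5, by norm_num, by decide, hp8, fun q hq ↦ ?_⟩
      have hq : q % 8 = 5 := hq
      have hodd : Odd q := Nat.odd_iff.mpr (by omega)
      refine ⟨hodd, ?_⟩
      rw [jacobiSym.at_neg_two hodd, ZMod.χ₈'_nat_eq_if_mod_eight, if_neg (by omega),
        if_neg (by omega)]
  · obtain ⟨m', rfl⟩ := Int.natCast_dvd.mpr hlm
    obtain ⟨c, hc⟩ := exists_jacobiSym_eq_neg_one hl hl2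
    have hm0 : m' ≠ 0 := by rintro rfl; simp at hm
    have hlm' : l.Coprime (4 * m'.natAbs) := by
      refine Nat.Coprime.mul_right ?_ ?_
      · simpa using Nat.Coprime.pow_right 2 (Nat.coprime_two_right.mpr hl2)
      · rw [hl.coprime_iff_not_dvd, ← Int.natCast_dvd]
        intro h
        have := hm l (mul_dvd_mul_left _ h)
        exact hl.one_lt.ne' (by simpa [Int.isUnit_iff_natAbs_eq] using this)
    -- The symbol of `m'` at `q` depends only on `q` mod `4 * |m'|`, so the residue 1 makes it 1. As
    -- `q ≡ 1` mod 4, reciprocity turns the symbol of `l` at `q` into that of `c` at `l`, which is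
    -- -1.
    obtain ⟨r, hr1, hr2⟩ := Nat.chineseRemainder hlm'.symm 1 c
    refine ⟨4 * m'.natAbs * l, r, by simp [hm0, hl.ne_zero], ?_, ?_, fun q hq ↦ ?_⟩
    · refine Nat.Coprime.mul_right ?_ ?_
      · rw [Nat.Coprime, hr1.gcd_eq, Nat.gcd_one_left]
      · rw [Nat.Coprime, hr2.gcd_eq]
        exact coprime_of_jacobiSym_eq_neg_one hc
    · refine Nat.Coprime.mul_right (Nat.Coprime.mul_right hp4 ?_) ?_
      · rw [hp.coprime_iff_not_dvd, ← Int.natCast_dvd]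
        exact fun h ↦ hpm (h.mul_left _)
      · rw [hp.coprime_iff_not_dvd]
        exact fun h ↦ hpm ((Int.natCast_dvd_natCast.mpr h).mul_right _)
    · have hq1 : q ≡ 1 [MOD 4 * m'.natAbs] := (hq.of_mul_right _).trans hr1
      have hq2 : q ≡ c [MOD l] := (hq.of_mul_left _).trans hr2
      have hq4 : q % 4 = 1 := hq1.of_mul_right _
      have hodd : Odd q := Nat.odd_iff.mpr (by omega)
      refine ⟨hodd, ?_⟩
      rw [jacobiSym.mul_left, jacobiSym.quadratic_reciprocity_one_mod_four' hl2 hq4,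
        jacobiSym_congr hq2, hc, jacobiSym.mod_right _ hodd, hq1,
        ← jacobiSym.mod_right _ odd_one, jacobiSym.one_right, mul_one]

/-- The modulus controlling `m` is prime to `p`, so the conditions at `m` and at `p` can be imposed
together, and Dirichlet's theorem supplies the prime. -/
theorem exists_prime_jacobiSym_eq_neg_one {m : ℤ} (hm : Squarefree m) (hm1 : m ≠ 1) {p : ℕ}
    (hp : p.Prime) (hp4 : p % 4 = 1) (hpm : ¬ (p : ℤ) ∣ m) :
    ∃ q : ℕ, q.Prime ∧ Odd q ∧ jacobiSym m q = -1 ∧ jacobiSym p q = -1 ∧ jacobiSym q p = -1 := by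
  have hp2 : Odd p := Nat.odd_iff.mpr (by omega)
  obtain ⟨M, r, hM, hrM, hpM, h⟩ := exists_modulus_jacobiSym_eq_neg_one hm hm1 hp hp2 hpm
  obtain ⟨c, hc⟩ := exists_jacobiSym_eq_neg_one hp hp2
  obtain ⟨b, hb1, hb2⟩ := Nat.chineseRemainder hpM.symm r c
  obtain ⟨q, -, hq, hqb⟩ := Nat.forall_exists_prime_gt_and_modEq 0 (q := M * p) (a := b)
    (mul_ne_zero hM hp.ne_zero) (Nat.Coprime.mul_right (by rwa [Nat.Coprime, hb1.gcd_eq])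
      (by rw [Nat.Coprime, hb2.gcd_eq]; exact coprime_of_jacobiSym_eq_neg_one hc))
  obtain ⟨hodd, hqm⟩ := h q ((hqb.of_mul_right _).trans hb1)
  have hqp : jacobiSym q p = -1 := by
    rw [jacobiSym_congr ((hqb.of_mul_left _).trans hb2), hc]
  exact ⟨q, hq, hodd, hqm, by rw [jacobiSym.quadratic_reciprocity_one_mod_four hp4 hodd, hqp], hqp⟩

/-- A denominator of `w` divisible by `p` would put `p ^ 2` into `d * w.num ^ 2`. Since `p` divides
`d` only once, `w` would not be reduced. -/
theorem dvd_of_mul_sq_eq {d : ℤ} (hd : Squarefree d) {p : ℕ} (hp : p.Prime) (hpd : (p : ℤ) ∣ d)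
    {w : ℚ} {m : ℤ} (h : (d : ℚ) * w ^ 2 = m) : (p : ℤ) ∣ m := by
  have hpZ : Prime (p : ℤ) := Nat.prime_iff_prime_int.mp hp
  have hden : (w.den : ℚ) ≠ 0 := by exact_mod_cast w.den_nz
  have hZ : d * w.num ^ 2 = m * w.den ^ 2 := by
    have : (d : ℚ) * w.num ^ 2 = m * w.den ^ 2 := by
      rw [← h]
      nth_rewrite 2 [← Rat.num_div_den w]
      field_simp
    exact_mod_cast this
  by_contra hpm
  have hb : (p : ℤ) ∣ w.den :=
    hpZ.dvd_of_dvd_pow ((hpZ.dvd_or_dvd (hZ ▸ hpd.mul_right _)).resolve_left hpm)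
  obtain ⟨e, he⟩ := hpd
  have hpe : (p : ℤ) ∣ e * w.num ^ 2 := by
    have h2 : (p : ℤ) * p ∣ p * (e * w.num ^ 2) := by
      rw [← mul_assoc, ← he, hZ, ← pow_two]
      exact (pow_dvd_pow_of_dvd hb 2).mul_left _
    exact (mul_dvd_mul_iff_left hpZ.ne_zero).mp h2
  rcases hpZ.dvd_or_dvd hpe with h1 | h1
  · exact hpZ.not_isUnit (hd p (he ▸ mul_dvd_mul_left _ h1))
  · have h2 : p ∣ w.num.natAbs := Int.natCast_dvd.mp (hpZ.dvd_of_dvd_pow h1)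
    have h3 : p ∣ w.den := by exact_mod_cast hb
    exact hp.one_lt.ne' (Nat.dvd_one.mp (w.reduced ▸ Nat.dvd_gcd h2 h3))

end Arithmetic

/-! ### Conjugation and norms in `K_d` -/

section QuadraticField

open NumberField Ideal Polynomial IntermediateField

variable {d : ℤ}

theorem minpoly_sqrt (hd : Squarefree d) (hd1 : d ≠ 1) :
    minpoly ℚ (Complex.sqrt (d : ℂ)) = X ^ 2 - C (d : ℚ) := by
  refine (minpoly.eq_of_irreducible_of_monic ?_ ?_ (monic_X_pow_sub_C _ two_ne_zero)).symm
  · refine X_pow_sub_C_irreducible_of_prime Nat.prime_two fun b hb ↦ ?_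
    obtain ⟨k, rfl⟩ := Rat.isSquare_intCast_iff.mp ⟨b, by rw [← hb, pow_two]⟩
    exact hd1 (by rw [← pow_two]; exact Int.isUnit_sq (hd k dvd_rfl))
  · simp [sqrt_pow_two]

theorem finrank_K (hd : Squarefree d) (hd1 : d ≠ 1) : Module.finrank ℚ (K d) = 2 := by
  rw [K, adjoin.finrank (isIntegral_sqrt d), minpoly_sqrt hd hd1, natDegree_X_pow_sub_C]

/-- `√d` as an element of `K_d`. -/
noncomputable def root (d : ℤ) : K d :=
  AdjoinSimple.gen ℚ (Complex.sqrt (d : ℂ))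

theorem root_sq (d : ℤ) : root d ^ 2 = d := by
  apply Subtype.ext
  push_cast
  exact sqrt_pow_two d

theorem exists_eq_add_mul_root (hd : Squarefree d) (hd1 : d ≠ 1) (x : K d) :
    ∃ u v : ℚ, x = u + v * root d := by
  obtain ⟨f, hf, hx⟩ := (adjoin.powerBasis (isIntegral_sqrt d)).exists_eq_aeval x
  rw [adjoin.powerBasis_dim, minpoly_sqrt hd hd1, natDegree_X_pow_sub_C] at hf
  obtain ⟨b, c, rfl⟩ := exists_eq_X_add_C_of_natDegree_le_one (Nat.le_of_lt_succ hf)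
  refine ⟨c, b, ?_⟩
  rw [hx, adjoin.powerBasis_gen, map_add, map_mul, aeval_C, aeval_C, aeval_X, add_comm]
  rfl

theorem exists_conj (hd : Squarefree d) (hd1 : d ≠ 1) :
    ∃ σ : K d ≃+* K d, σ (root d) = -root d := by
  have hmem : -root d ∈ (minpoly ℚ (Complex.sqrt (d : ℂ))).aroots (K d) := by
    rw [minpoly_sqrt hd hd1, mem_aroots]
    exact ⟨(monic_X_pow_sub_C _ two_ne_zero).ne_zero, by simp [root_sq]⟩
  let φ : K d →ₐ[ℚ] K d :=
    (algHomAdjoinIntegralEquiv ℚ (isIntegral_sqrt d)).symm ⟨-root d, hmem⟩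
  exact ⟨RingEquiv.ofBijective φ φ.bijective,
    algHomAdjoinIntegralEquiv_symm_apply_gen ℚ (isIntegral_sqrt d) ⟨-root d, hmem⟩⟩

theorem exists_intCast_eq {F : Type*} [Field F] [NumberField F] (x : 𝓞 F) {r : ℚ}
    (h : (x : F) = r) : ∃ n : ℤ, x = n ∧ r = n := by
  have hr : IsIntegral ℤ r := by
    rw [← isIntegral_algebraMap_iff (algebraMap ℚ F).injective, eq_ratCast, ← h]
    exact x.isIntegral_coe
  obtain ⟨n, rfl⟩ := IsIntegrallyClosed.isIntegral_iff.mp hr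
  exact ⟨n, RingOfIntegers.ext (by simp [h]), by simp⟩

/-- `√d` as an element of the ring of integers of `K_d`. -/
noncomputable def intRoot (d : ℤ) : 𝓞 (K d) :=
  ⟨root d, IsIntegral.of_pow two_pos (by rw [root_sq]; exact isIntegral_algebraMap (x := d))⟩

theorem intRoot_sq (d : ℤ) : intRoot d ^ 2 = d :=
  RingOfIntegers.ext (by push_cast; exact root_sq d)

/-- The nontrivial automorphism of the ring of integers of `K_d`, with the traces and norms
it gives rise to. -/
theorem exists_conj_ringOfIntegers (hd : Squarefree d) (hd1 : d ≠ 1) :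
    ∃ σ : 𝓞 (K d) ≃+* 𝓞 (K d), σ (intRoot d) = -intRoot d ∧
      ∀ x, ∃ t n : ℤ, x + σ x = t ∧ x * σ x = n ∧
        ∀ p : ℕ, p.Prime → (p : ℤ) ∣ d → (p : ℤ) ∣ t ^ 2 - 4 * n := by
  obtain ⟨σ, hσ⟩ := exists_conj hd hd1
  refine ⟨RingOfIntegers.mapRingEquiv σ, RingOfIntegers.ext hσ, fun x ↦ ?_⟩
  obtain ⟨u, v, hx⟩ := exists_eq_add_mul_root hd hd1 (x : K d)
  have hσx : σ x = u - v * root d := by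
    rw [hx, map_add, map_mul, hσ, map_ratCast, map_ratCast, mul_neg, sub_eq_add_neg]
  obtain ⟨t, ht, hut⟩ := exists_intCast_eq (x + RingOfIntegers.mapRingEquiv σ x) (r := 2 * u) (by
    change (x : K d) + σ x = (2 * u : ℚ)
    rw [hσx, hx]
    push_cast
    ring)
  obtain ⟨n, hn, hun⟩ := exists_intCast_eq (x * RingOfIntegers.mapRingEquiv σ x)
    (r := u ^ 2 - d * v ^ 2) (by
      change (x : K d) * σ x = (u ^ 2 - d * v ^ 2 : ℚ)
      rw [hσx, hx]
      push_cast
      linear_combination (-(v : K d) ^ 2) * root_sq d)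
  -- The discriminant of `x = u + v√d` is `t ^ 2 - 4 * n = d * (2 * v) ^ 2`.
  refine ⟨t, n, ht, hn, fun p hp hpd ↦ dvd_of_mul_sq_eq hd hp hpd (w := 2 * v) ?_⟩
  push_cast
  rw [← hut, ← hun]
  ring

theorem intCast_dvd_intCast {F : Type*} [Field F] [NumberField F] {a b : ℤ}
    (h : (a : 𝓞 F) ∣ b) : a ∣ b := by
  obtain ⟨c, hc⟩ := h
  rcases eq_or_ne a 0 with rfl | ha
  · have : (b : 𝓞 F) = 0 := by simpa using hc
    rw [Int.cast_eq_zero] at this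
    exact this ▸ dvd_rfl
  · have ha' : (a : F) ≠ 0 := Int.cast_ne_zero.mpr ha
    obtain ⟨n, -, hn⟩ := exists_intCast_eq c (r := b / a) (by
      have := congrArg (algebraMap (𝓞 F) F) hc
      simp only [map_intCast, map_mul] at this
      push_cast
      rw [this, mul_div_cancel_left₀ _ ha'])
    refine ⟨n, ?_⟩
    rw [div_eq_iff (Int.cast_ne_zero.mpr ha)] at hn
    rw [mul_comm]
    exact_mod_cast hn

/-- If `√d ≡ t` mod the conjugation-stable `P`, then also `-√d ≡ t`, so `p ∣ 2 * t`. Hence `p ∣ t`,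
and `√d` lies in `P`. -/
theorem dvd_of_card_absNorm_eq_one (hd : Squarefree d) (hd1 : d ≠ 1) {p : ℕ} (hp : p.Prime)
    (hp2 : p ≠ 2) (ha : a d p = 1) : (p : ℤ) ∣ d := by
  have hpZ : Prime (p : ℤ) := Nat.prime_iff_prime_int.mp hp
  obtain ⟨σ, hσ, -⟩ := exists_conj_ringOfIntegers hd hd1
  obtain ⟨hsub, ⟨P, hP⟩⟩ := Nat.card_eq_one_iff_unique.mp ha
  have hσP : P.comap σ = P :=
    Subtype.mk.inj (hsub.elim ⟨P.comap σ, (absNorm_comap_ringEquiv σ P).trans hP⟩ ⟨P, hP⟩)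
  obtain ⟨t, ht⟩ := exists_sub_intCast_mem hp hP (intRoot d)
  have ht' : -intRoot d - t ∈ P := by
    have := hσP.symm ▸ ht
    rwa [mem_comap, map_sub, hσ, map_intCast] at this
  have h2t : ((2 * t : ℤ) : 𝓞 (K d)) ∈ P := by
    have := P.neg_mem (P.add_mem ht ht')
    push_cast
    convert this using 1
    ring
  rw [intCast_mem_iff_of_absNorm_eq hp hP] at h2t
  have hpt : (p : ℤ) ∣ t := (hpZ.dvd_or_dvd h2t).resolve_left fun h ↦
    hp2 ((Nat.prime_dvd_prime_iff_eq hp Nat.prime_two).mp (by exact_mod_cast h))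
  have hr : intRoot d ∈ P := by
    simpa using P.add_mem ht ((intCast_mem_iff_of_absNorm_eq hp hP t).mpr hpt)
  rw [← intCast_mem_iff_of_absNorm_eq hp hP, ← intRoot_sq]
  exact P.pow_mem_of_mem hr 2 two_pos

/-- If every ideal is principal, an odd prime modulo which `d` is a nonzero square is, up to sign,
the norm of an integer. -/
theorem exists_mul_conj_eq_prime [IsPrincipalIdealRing (𝓞 (K d))]
    {σ : 𝓞 (K d) ≃+* 𝓞 (K d)} (hσ : σ (intRoot d) = -intRoot d)
    (hnorm : ∀ x, ∃ n : ℤ, x * σ x = n) (htrace : ∀ x, ∃ t : ℤ, x + σ x = t)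
    {q : ℕ} (hq : q.Prime) (hq2 : Odd q) (hqd : jacobiSym d q = 1) :
    ∃ x : 𝓞 (K d), x * σ x = (q : ℤ) ∨ x * σ x = (-q : ℤ) := by
  have := Fact.mk hq
  have hqZ : Prime (q : ℤ) := Nat.prime_iff_prime_int.mp hq
  have hndvd : ¬ (q : ℤ) ∣ d := fun h ↦ by
    rw [jacobiSym.mod_left, Int.emod_eq_zero_of_dvd h, jacobiSym.zero_left hq.one_lt] at hqd
    simp at hqd
  obtain ⟨s, hs⟩ := ZMod.isSquare_of_jacobiSym_eq_one hqd
  obtain ⟨t, rfl⟩ := ZMod.intCast_surjective s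
  have ht : (q : ℤ) ∣ t ^ 2 - d := by
    rw [← ZMod.intCast_zmod_eq_zero_iff_dvd]
    push_cast
    rw [hs]
    ring
  -- If `q` divided `z - √d`, it would divide the trace `2 * z`, hence `z` and then `d`.
  have hconst (z : ℤ) (ht : (q : ℤ) ∣ z ^ 2 - d) : ¬ ((q : ℤ) : 𝓞 (K d)) ∣ z - intRoot d := by
    rintro ⟨β, hβ⟩
    obtain ⟨b, hb⟩ := htrace β
    have h1 := congrArg σ hβ
    rw [map_sub, map_mul, hσ, map_intCast, map_intCast] at h1
    have h2 : (q : ℤ) ∣ 2 * z := intCast_dvd_intCast (F := K d)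
      ⟨b, by push_cast at *; linear_combination hβ + h1 + (q : 𝓞 (K d)) * hb⟩
    have h3 : (q : ℤ) ∣ z := (hqZ.dvd_or_dvd h2).resolve_left fun h ↦ by
      rw [(Nat.prime_dvd_prime_iff_eq hq Nat.prime_two).mp (by exact_mod_cast h)] at hq2
      exact absurd hq2 (by decide)
    exact hndvd ((dvd_sub_right (h3.trans (dvd_pow_self z two_ne_zero))).mp ht)
  have hnot : ¬ Prime ((q : ℤ) : 𝓞 (K d)) := fun hprime ↦ by
    have hdvd : ((q : ℤ) : 𝓞 (K d)) ∣ (t - intRoot d) * (((-t : ℤ) : 𝓞 (K d)) - intRoot d) := by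
      obtain ⟨e, he⟩ := ht
      refine ⟨-e, ?_⟩
      have he' := congrArg (Int.cast : ℤ → 𝓞 (K d)) he
      push_cast at he' ⊢
      linear_combination intRoot_sq d - he'
    exact (hprime.dvd_or_dvd hdvd).elim (hconst t ht) (hconst (-t) (by rwa [neg_sq]))
  have hunit (x : 𝓞 (K d)) (n : ℤ) (hx : x * σ x = n) (hn : IsUnit n) : IsUnit x :=
    isUnit_of_mul_isUnit_left (y := σ x) (by
      rw [hx]; exact hn.map (Int.castRingHom (𝓞 (K d))))
  have hnu : ¬ IsUnit ((q : ℤ) : 𝓞 (K d)) := fun h ↦ hqZ.not_isUnit <| isUnit_of_dvd_one <|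
    intCast_dvd_intCast (F := K d) (by simpa using h.dvd (a := 1))
  -- In a principal ideal ring `q` is then reducible. The norms of its two nonunit factors are
  -- nonunits with product `q ^ 2`, so each is `q` or `-q`.
  rw [← UniqueFactorizationMonoid.irreducible_iff_prime, irreducible_iff] at hnot
  push Not at hnot
  obtain ⟨α, β, hαβ, hα, hβ⟩ := hnot hnu
  obtain ⟨m, hm⟩ := hnorm α
  obtain ⟨n, hn⟩ := hnorm β
  have hmn : m * n = (q : ℤ) ^ 2 := by
    have h1 := congrArg σ hαβ
    rw [map_mul, map_intCast] at h1
    have : ((m * n : ℤ) : 𝓞 (K d)) = ((q ^ 2 : ℤ) : 𝓞 (K d)) := by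
      push_cast at *
      rw [← hm, ← hn, pow_two]
      nth_rewrite 2 [h1]
      rw [hαβ]
      ring
    exact_mod_cast this
  have hm1 : ¬ IsUnit m := fun h ↦ hα (hunit α m hm h)
  have hn1 : ¬ IsUnit n := fun h ↦ hβ (hunit β n hn h)
  have hnat : m.natAbs * n.natAbs = q ^ 2 := by
    rw [← Int.natAbs_mul, hmn, Int.natAbs_pow, Int.natAbs_natCast]
  have hmq : m.natAbs = q :=
    ((hq.mul_eq_prime_sq_iff (by rwa [Ne, ← Int.isUnit_iff_natAbs_eq])
      (by rwa [Ne, ← Int.isUnit_iff_natAbs_eq])).mp hnat).1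
  refine ⟨α, ?_⟩
  rcases Int.natAbs_eq m with h | h <;> rw [hmq] at h <;> rw [hm, h]
  · exact Or.inl rfl
  · exact Or.inr rfl

theorem eq_of_classNumber_eq_one (hd : Squarefree d) (hd1 : d ≠ 1) {p : ℕ} (hp : p.Prime)
    (hp4 : p % 4 = 1) (hpd : (p : ℤ) ∣ d) (hh : h d = 1) : d = p := by
  have := Fact.mk hp
  have : IsPrincipalIdealRing (𝓞 (K d)) := classNumber_eq_one_iff.mp hh
  have hpZ : Prime (p : ℤ) := Nat.prime_iff_prime_int.mp hp
  have hpd' := hpd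
  obtain ⟨m, hm⟩ := hpd'
  by_contra hdp
  have hm1 : m ≠ 1 := by rintro rfl; exact hdp (by simpa using hm)
  have hpm : ¬ (p : ℤ) ∣ m := fun h ↦ hpZ.not_isUnit (hd p (hm ▸ mul_dvd_mul_left _ h))
  obtain ⟨q, hq, hq2, hqm, hpq, hqp⟩ := exists_prime_jacobiSym_eq_neg_one
    (hd.squarefree_of_dvd (hm ▸ dvd_mul_left m p)) hm1 hp hp4 hpm
  have hqd : jacobiSym d q = 1 := by rw [hm, jacobiSym.mul_left, hpq, hqm]; norm_num
  obtain ⟨σ, hσ, hform⟩ := exists_conj_ringOfIntegers hd hd1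
  obtain ⟨x, hx⟩ := exists_mul_conj_eq_prime hσ
    (fun x ↦ (hform x).elim fun _ h ↦ h.imp fun _ h ↦ h.2.1)
    (fun x ↦ (hform x).imp fun _ h ↦ h.choose_spec.1) hq hq2 hqd
  obtain ⟨t, n, -, hn, hdvd⟩ := hform x
  have hnq : n = q ∨ n = -q := by
    rw [hn] at hx
    exact_mod_cast hx
  have hp2 : Odd p := Nat.odd_iff.mpr (by omega)
  have hneg : jacobiSym (-1) p = 1 := by
    rw [jacobiSym.at_neg_one hp2, ZMod.χ₄_nat_one_mod_four hp4]
  have hJ : jacobiSym (4 * n) p = -1 := by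
    rw [jacobiSym.mul_left, jacobiSym.at_four hp2, one_mul]
    rcases hnq with rfl | rfl
    · exact hqp
    · rw [neg_eq_neg_one_mul, jacobiSym.mul_left, hneg, hqp, one_mul]
  -- `t ^ 2 ≡ 4 * n` mod `p`, so the square of a symbol would equal -1.
  have hsq : jacobiSym (t ^ 2) p = jacobiSym (4 * n) p :=
    jacobiSym.mod_left' (Int.emod_eq_emod_iff_emod_sub_eq_zero.mpr
      (Int.emod_eq_zero_of_dvd (hdvd p hp hpd)))
  rw [hJ, jacobiSym.pow_left] at hsq
  nlinarith [sq_nonneg (jacobiSym t p)]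

end QuadraticField

end Quad

theorem mainTheorem4 (d : ℤ) (hd : Squarefree d) (hd1 : d ≠ 1)
    (p : ℕ) (hp : p.Prime) (hp4 : p % 4 = 1) :
    (Quad.a d p = 1 ↔ Quad.Ramifies d p) ∧
      (Quad.h d = 1 → Quad.a d p = 1 → d = (p : ℤ)) :=
  ⟨Quad.card_absNorm_eq_one_iff (Quad.finrank_K hd hd1) hp, fun hh ha ↦
    Quad.eq_of_classNumber_eq_one hd hd1 hp hp4
      (Quad.dvd_of_card_absNorm_eq_one hd hd1 hp (by rintro rfl; simp at hp4) ha) hh⟩
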